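/- Let $\{B(t):t\ge 0\}$ be a standard Brownian motion, let $T>0$, $0<a_1<a_2$ and $c_1,c_2\in\mathbb{R}$ with $c_1>c_2$. Put $$\pi_T(a_1,a_2):=\mathbb{P}\Big(\sup_{t\in[0,T]}(B(t)-c_1t)>a_1,\ \sup_{t\in[0,T]}(B(t)-c_2t)>a_2\Big),$$ let $t^*:=\frac{a_2-a_1}{c_1-c_2}$ be the point of intersection of the lines $a_1+c_1t$ and $a_2+c_2t$, and let $\Psi(x):=\mathbb{P}(\mathcal{N}>x)$, where $\mathcal{N}$ is a standard normal random variable. Suppose that $t^*\ge T$. Then $$\pi_T(a_1,a_2)=\Psi\left(\frac{a_2+c_2T}{\sqrt{T}}\right)+e^{-2a_2c_2}\,\Psi\left(\frac{a_2-c_2T}{\sqrt{T}}\right),$$ and moreover $$\pi_T(a_1,a_2)=\mathbb{P}\Big(\sup_{t\in[0,T]}(B(t)-c_2t)>a_2\Big).$$ -/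

import Mathlib

open MeasureTheory ProbabilityTheory
open scoped NNReal

noncomputable section

/-- The running supremum `sup_{t ∈ [0,T]} (B(t) - c t)` along the path indexed by `ω`.
It is finite (so the real supremum is genuine) whenever that path is continuous. -/
def driftedSup {Ω : Type*} (B : ℝ≥0 → Ω → ℝ) (c : ℝ) (T : ℝ≥0) (ω : Ω) : ℝ :=
  ⨆ t : Set.Icc (0 : ℝ≥0) T, (B t ω - c * ((t : ℝ≥0) : ℝ))

/-- The one-dimensional tail probability `ℙ(sup_{t ∈ [0,T]} (B(t) - c t) > a)`. -/
def marginalSurvival {Ω : Type*} [MeasurableSpace Ω] (P : Measure Ω) (B : ℝ≥0 → Ω → ℝ)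
    (c : ℝ) (T : ℝ≥0) (a : ℝ) : ℝ :=
  P.real {ω | driftedSup B c T ω > a}

/-- The joint survival function `π_T(a₁, a₂)`, that is
`ℙ(sup_{t ∈ [0,T]} (B(t) - c₁ t) > a₁, sup_{t ∈ [0,T]} (B(t) - c₂ t) > a₂)`. -/
def jointSurvival {Ω : Type*} [MeasurableSpace Ω] (P : Measure Ω) (B : ℝ≥0 → Ω → ℝ)
    (c₁ c₂ : ℝ) (T : ℝ≥0) (a₁ a₂ : ℝ) : ℝ :=
  P.real {ω | driftedSup B c₁ T ω > a₁ ∧ driftedSup B c₂ T ω > a₂}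

/-- The standard normal tail `Ψ(x) = ℙ(𝒩 > x)`. -/
def gaussianTail (x : ℝ) : ℝ :=
  (gaussianReal 0 1).real (Set.Ioi x)

/-- The time `t*` at which the lines `a₁ + c₁ t` and `a₂ + c₂ t` intersect (for `c₁ ≠ c₂`). -/
def crossingTime (a₁ a₂ c₁ c₂ : ℝ) : ℝ :=
  (a₂ - a₁) / (c₁ - c₂)

end

/-! Up to `t*` the line a₁ + c₁t lies below a₂ + c₂t, so a path above the second line is at that
moment above the first, and the joint event is a.s. the marginal one
(`jointSurvival_eq_marginalSurvival`). The marginal law (`IsBrownianReal.measure_lt_driftedSup`) is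
a reflection principle for X_t = B_t - ct, proved on grids. The path up to its first grid exceedance
of a is independent of the remaining increment Z, and replacing Z by -Z costs the density ratio
exp(2cZ). As the mesh shrinks the overshoot above a vanishes, so P(sup X > a, X_T ≤ a) =
E[exp(2c(X_T - a)); X_T > a]. This is a Gaussian integral; adding P(X_T > a) gives the formula. -/

open Filter Topology

/-- `k` is the first index at which the sequence `x` exceeds the level `a`. -/
def IsFirstExceed (x : ℕ → ℝ) (a : ℝ) (k : ℕ) : Prop :=
  a < x k ∧ ∀ j < k, x j ≤ a

lemma IsFirstExceed.unique {x : ℕ → ℝ} {a : ℝ} {k l : ℕ} (hk : IsFirstExceed x a k)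
    (hl : IsFirstExceed x a l) : k = l :=
  le_antisymm (not_lt.1 fun h => (hk.2 l h).not_gt hl.1) (not_lt.1 fun h => (hl.2 k h).not_gt hk.1)

lemma exists_isFirstExceed {x : ℕ → ℝ} {a : ℝ} {m : ℕ} (h : a < x m) :
    ∃ k ≤ m, IsFirstExceed x a k := by
  classical
  have hex : ∃ k, a < x k := ⟨m, h⟩
  exact ⟨Nat.find hex, Nat.find_le h, Nat.find_spec hex,
    fun j hj => not_lt.1 (Nat.find_min hex hj)⟩

/-! ### Gaussian reflection and exponential tilting -/

/-- Under the law `N(-c s, s)`, reflecting the variable amounts to tilting by `exp (2 c z)`. -/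
lemma lintegral_gaussianReal_comp_neg (c : ℝ) (s : ℝ≥0) {g : ℝ → ENNReal} (hg : Measurable g) :
    ∫⁻ z, g (-z) ∂gaussianReal (-(c * s)) s =
      ∫⁻ z, ENNReal.ofReal (Real.exp (2 * c * z)) * g z ∂gaussianReal (-(c * s)) s := by
  by_cases hs : s = 0
  · subst hs
    have : Measurable fun z => ENNReal.ofReal (Real.exp (2 * c * z)) * g z := by fun_prop
    simp [lintegral_dirac' _ this]
  rw [gaussianReal_of_var_ne_zero _ hs,
    lintegral_withDensity_eq_lintegral_mul _ (by fun_prop) (by fun_prop),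
    lintegral_withDensity_eq_lintegral_mul _ (by fun_prop) (by fun_prop),
    -- After z ↦ -z the claim is pointwise: the density f of N(-cs, s) satisfies f(-z) = exp(2cz)
    -- f(z).
    ← lintegral_neg_eq_self]
  congr 1
  ext z
  have hs' : (s : ℝ) ≠ 0 := by exact_mod_cast hs
  simp only [Pi.mul_apply, neg_neg, gaussianPDF]
  rw [← mul_assoc, ← ENNReal.ofReal_mul (gaussianPDFReal_nonneg _ _ _)]
  congr 2
  simp only [gaussianPDFReal]
  rw [mul_assoc _ (Real.exp _), ← Real.exp_add]
  congr 2
  field_simp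
  ring

/-- Fubini lets the one-dimensional reflection act with U frozen; U will be the path up to the first
exceedance and Z the increment after it. -/
lemma lintegral_indepFun_comp_neg {Ω E : Type*} [MeasurableSpace Ω] [MeasurableSpace E]
    {P : Measure Ω} [IsProbabilityMeasure P] {U : Ω → E} {Z : Ω → ℝ} {c : ℝ} {s : ℝ≥0}
    (hU : AEMeasurable U P) (hZ : HasLaw Z (gaussianReal (-(c * s)) s) P) (h : U ⟂ᵢ[P] Z)
    {G : E × ℝ → ENNReal} (hG : Measurable G) :
    ∫⁻ ω, G (U ω, -Z ω) ∂P =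
      ∫⁻ ω, ENNReal.ofReal (Real.exp (2 * c * Z ω)) * G (U ω, Z ω) ∂P := by
  have key (F : E × ℝ → ENNReal) (hF : Measurable F) :
      ∫⁻ ω, F (U ω, Z ω) ∂P =
        ∫⁻ u, ∫⁻ z, F (u, z) ∂gaussianReal (-(c * s)) s ∂(P.map U) := by
    have : IsProbabilityMeasure (P.map U) := Measure.isProbabilityMeasure_map hU
    rw [← lintegral_prod _ hF.aemeasurable, ← hZ.map_eq,
      ← (indepFun_iff_map_prod_eq_prod_map_map hU hZ.aemeasurable).1 h,
      lintegral_map' hF.aemeasurable (hU.prodMk hZ.aemeasurable)]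
  rw [key (fun p => G (p.1, -p.2)) (by fun_prop),
    key (fun p => ENNReal.ofReal (Real.exp (2 * c * p.2)) * G p) (by fun_prop)]
  refine lintegral_congr fun u => ?_
  exact lintegral_gaussianReal_comp_neg c s (g := fun z => G (u, z)) (by fun_prop)

lemma gaussianReal_Ioi_eq_standard (m : ℝ) {v : ℝ≥0} (hv : v ≠ 0) (a : ℝ) :
    gaussianReal m v (Set.Ioi a) = gaussianReal 0 1 (Set.Ioi ((a - m) / √(v : ℝ))) := by
  have hv' : 0 < √(v : ℝ) := Real.sqrt_pos.2 (by positivity)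
  have h : (gaussianReal 0 1).map (fun x => √(v : ℝ) * x + m) = gaussianReal m v := by
    have : (fun x => √(v : ℝ) * x + m) = (fun x => x + m) ∘ fun x => √(v : ℝ) * x := rfl
    rw [this, ← Measure.map_map (by fun_prop) (by fun_prop), gaussianReal_map_const_mul,
      gaussianReal_map_add_const]
    congr 1
    · simp
    · ext; simp
  rw [← h, Measure.map_apply (by fun_prop) measurableSet_Ioi]
  congr 1
  ext x
  simp only [Set.mem_preimage, Set.mem_Ioi]
  rw [div_lt_iff₀ hv']
  constructor <;> intro <;> linarith

/-! ### Reflection of the drifted increment after a grid time -/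

namespace ProbabilityTheory.IsPreBrownianReal

variable {Ω : Type*} [MeasurableSpace Ω] {P : Measure Ω} {B : ℝ≥0 → Ω → ℝ}

lemma hasLaw_sub_drift (hB : IsPreBrownianReal B P) (c : ℝ) {s t : ℝ≥0} (hst : s ≤ t) :
    HasLaw (fun ω => (B t ω - c * t) - (B s ω - c * s))
      (gaussianReal (-(c * (t - s : ℝ≥0))) (t - s)) P := by
  have h := gaussianReal_sub_const (hB.hasLaw_sub t s) (c * (t - s : ℝ≥0))
  have hn : nndist t.1 s.1 = t - s := by
    apply NNReal.coe_injective
    rw [coe_nndist, Real.dist_eq, NNReal.coe_sub hst, abs_of_nonneg]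
    · rfl
    exact sub_nonneg.2 (NNReal.coe_le_coe.2 hst)
  rw [hn, zero_sub] at h
  refine h.congr (.of_forall fun ω => ?_)
  simp only [Pi.sub_apply, NNReal.coe_sub hst]
  ring

lemma hasLaw_drift (hB : IsPreBrownianReal B P) (c : ℝ) (t : ℝ≥0) :
    HasLaw (fun ω => B t ω - c * t) (gaussianReal (-(c * t)) t) P := by
  simpa using gaussianReal_sub_const (hB.hasLaw_eval t) (c * t)

/-- Discrete reflection identity at the first index of a grid where the drifted path exceeds
`a`. -/
lemma lintegral_first_exceed_reflect (hB : IsPreBrownianReal B P) (c a : ℝ) {T : ℝ≥0}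
    {t : ℕ → ℝ≥0} (ht : Monotone t) {k : ℕ} (hk : t k ≤ T) :
    P {ω | IsFirstExceed (fun j => B (t j) ω - c * t j) a k ∧ B T ω - c * T ≤ a} =
      ∫⁻ ω, {ω | IsFirstExceed (fun j => B (t j) ω - c * t j) a k ∧
          2 * (B (t k) ω - c * t k) - a ≤ B T ω - c * T}.indicator
        (fun ω => ENNReal.ofReal
          (Real.exp (2 * c * ((B T ω - c * T) - (B (t k) ω - c * t k))))) ω ∂P := by
  have := hB.isGaussianProcess.isProbabilityMeasure
  have hmeas (s : ℝ≥0) : AEMeasurable (fun ω => B s ω - c * s) P :=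
    (hB.aemeasurable s).sub_const _
  set U : Ω → Fin (k + 1) → ℝ := fun ω j => B (t j) ω - c * t j with hUdef
  set Z : Ω → ℝ := fun ω => (B T ω - c * T) - (B (t k) ω - c * t k) with hZdef
  have hU : AEMeasurable U P := aemeasurable_pi_lambda _ fun j => hmeas _
  have hZ := hB.hasLaw_sub_drift c hk
  have hind : U ⟂ᵢ[P] Z := by
    have h := (hB.indepFun_shift (t k)).symm.comp
      (φ := fun x (j : Fin (k + 1)) => x ⟨t j, ht (Nat.lt_succ_iff.1 j.2)⟩ - c * t j)
      (ψ := fun y => y (T - t k) - (c * T - c * t k)) (by fun_prop) (by fun_prop)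
    convert h using 1
    · rfl
    funext ω
    simp only [hZdef, Function.comp_apply, add_tsub_cancel_of_le hk]
    ring
  -- With second coordinate -Z the last condition reads X_T ≤ a; with Z it reads 2 X_{t_k} - a ≤
  -- X_T.
  set D : Set ((Fin (k + 1) → ℝ) × ℝ) :=
    {p | (a < p.1 (Fin.last k) ∧ ∀ j : Fin (k + 1), (j : ℕ) < k → p.1 j ≤ a) ∧
      p.1 (Fin.last k) - p.2 ≤ a} with hD
  have hDm : MeasurableSet D := by measurability
  have hfst (ω : Ω) : (∀ j : Fin (k + 1), (j : ℕ) < k → U ω j ≤ a) ↔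
      ∀ j < k, B (t j) ω - c * t j ≤ a :=
    ⟨fun h j hj => h ⟨j, by omega⟩ hj, fun h j hj => h j hj⟩
  have h := lintegral_indepFun_comp_neg hU hZ hind (G := D.indicator 1)
    (measurable_one.indicator hDm)
  have hN : NullMeasurableSet ((fun ω => (U ω, -Z ω)) ⁻¹' D) P :=
    (hU.prodMk hZ.aemeasurable.neg).nullMeasurableSet_preimage hDm
  calc _ = P ((fun ω => (U ω, -Z ω)) ⁻¹' D) := by
        congr 1
        ext ω
        simp only [Set.mem_ofPred_eq, Set.mem_preimage, hD, IsFirstExceed, hfst]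
        simp [hUdef, hZdef]
    _ = ∫⁻ ω, D.indicator 1 (U ω, -Z ω) ∂P := by
        rw [← lintegral_indicator_one₀ hN]
        rfl
    _ = _ := h
    _ = _ := by
        refine lintegral_congr fun ω => ?_
        have : (U ω, Z ω) ∈ D ↔
            ω ∈ {ω | IsFirstExceed (fun j => B (t j) ω - c * t j) a k ∧
              2 * (B (t k) ω - c * t k) - a ≤ B T ω - c * T} := by
          simp only [Set.mem_ofPred_eq, hD, IsFirstExceed, hfst]
          refine and_congr Iff.rfl ?_
          simp only [hUdef, hZdef, Fin.val_last]
          constructor <;> intro <;> linarith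
        by_cases hω : (U ω, Z ω) ∈ D
        · rw [Set.indicator_of_mem hω, Set.indicator_of_mem (this.1 hω)]; simp
        · rw [Set.indicator_of_notMem hω, Set.indicator_of_notMem (mt this.2 hω)]; simp

end ProbabilityTheory.IsPreBrownianReal

/-! ### Regular grids and the pathwise limit of the weights -/

/-- The `k`-th point of the regular grid of mesh `T / (n + 1)`. -/
noncomputable def regularGrid (T : ℝ≥0) (n k : ℕ) : ℝ≥0 := T * (k / (n + 1))

lemma regularGrid_mono (T : ℝ≥0) (n : ℕ) : Monotone (regularGrid T n) := by
  intro i j hij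
  unfold regularGrid
  gcongr

@[simp] lemma regularGrid_zero (T : ℝ≥0) (n : ℕ) : regularGrid T n 0 = 0 := by
  simp [regularGrid]

@[simp] lemma regularGrid_last (T : ℝ≥0) (n : ℕ) : regularGrid T n (n + 1) = T := by
  simp [regularGrid]

lemma regularGrid_le {T : ℝ≥0} {n k : ℕ} (hk : k ≤ n + 1) : regularGrid T n k ≤ T :=
  (regularGrid_mono T n hk).trans_eq (regularGrid_last T n)

lemma exists_tendsto_regularGrid {T s : ℝ≥0} (hT : 0 < T) (hs : s ≤ T) :
    ∃ k : ℕ → ℕ, (∀ n, k n ≤ n + 1) ∧ Tendsto (fun n => regularGrid T n (k n)) atTop (𝓝 s) := by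
  have hT' : (0 : ℝ) < T := by exact_mod_cast hT
  refine ⟨fun n => ⌊(s / T : ℝ) * ((n + 1 : ℕ) : ℝ)⌋₊, fun n => ?_, NNReal.tendsto_coe.1 ?_⟩
  · refine Nat.floor_le_of_le (mul_le_of_le_one_left (Nat.cast_nonneg _) ?_)
    exact div_le_one_of_le₀ (NNReal.coe_le_coe.2 hs) hT'.le
  · have h := ((tendsto_nat_floor_mul_div_atTop (R := ℝ) (a := s / T) (by positivity)).comp
      (tendsto_natCast_atTop_atTop.comp (tendsto_add_atTop_nat 1))).const_mul (T : ℝ)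
    rw [mul_div_cancel₀ _ hT'.ne'] at h
    refine h.congr fun n => ?_
    simp [regularGrid]

/-- The overshoot vanishes: the preceding grid value is at most a, and uniform continuity bounds the
last step. Starting at or below a ensures that there is a preceding point. -/
lemma eventually_isFirstExceed_lt {x : ℝ≥0 → ℝ} (hx : Continuous x) {a ε : ℝ} (h0 : x 0 ≤ a)
    (hε : 0 < ε) (T : ℝ≥0) :
    ∀ᶠ n in atTop, ∀ k ≤ n + 1, IsFirstExceed (fun j => x (regularGrid T n j)) a k →
      x (regularGrid T n k) < a + ε := by
  have huc : UniformContinuousOn x (Set.Icc 0 T) :=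
    isCompact_Icc.uniformContinuousOn_of_continuous hx.continuousOn
  obtain ⟨δ, hδ, huc⟩ := Metric.uniformContinuousOn_iff.1 huc ε hε
  have hlim : Tendsto (fun n : ℕ => (T : ℝ) * (1 / ((n : ℝ) + 1))) atTop (𝓝 0) := by
    simpa using (tendsto_one_div_add_atTop_nhds_zero_nat (𝕜 := ℝ)).const_mul (T : ℝ)
  filter_upwards [hlim.eventually_lt_const hδ] with n hn k hk hfirst
  cases k with
  | zero => exact absurd hfirst.1 (by simpa using h0)
  | succ k =>
    have h1 := hfirst.2 k (Nat.lt_succ_self k)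
    have h2 := huc (regularGrid T n (k + 1)) ⟨zero_le, regularGrid_le hk⟩
      (regularGrid T n k) ⟨zero_le, regularGrid_le (by omega)⟩ (by
        rw [NNReal.dist_eq]
        simp only [regularGrid]
        push_cast
        rw [← mul_sub, ← sub_div, add_sub_cancel_left, abs_of_nonneg (by positivity)]
        exact hn)
    have := (abs_lt.1 (Real.dist_eq _ _ ▸ h2)).2
    simp only at h1
    linarith

/-- The tilted weight collected at the first grid point where the path `x` exceeds `a`, on the
event that the terminal value lies above the reflected level. -/
noncomputable def reflectedWeight (c a : ℝ) (T : ℝ≥0) (n : ℕ) (x : ℝ≥0 → ℝ) : ENNReal :=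
  open scoped Classical in
  ∑ k ∈ Finset.range (n + 2),
    if IsFirstExceed (fun j => x (regularGrid T n j)) a k ∧
      2 * x (regularGrid T n k) - a ≤ x T then
      ENNReal.ofReal (Real.exp (2 * c * (x T - x (regularGrid T n k)))) else 0

lemma reflectedWeight_of_le {c a : ℝ} {T : ℝ≥0} (n : ℕ) {x : ℝ≥0 → ℝ} (h : x T ≤ a) :
    reflectedWeight c a T n x = 0 := by
  refine Finset.sum_eq_zero fun k _ => if_neg ?_
  rintro ⟨h1, h2⟩
  have := h1.1
  simp only at this
  linarith

lemma reflectedWeight_of_isFirstExceed {c a : ℝ} {T : ℝ≥0} {n k : ℕ} {x : ℝ≥0 → ℝ}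
    (hk : k ≤ n + 1) (h : IsFirstExceed (fun j => x (regularGrid T n j)) a k) :
    reflectedWeight c a T n x = open scoped Classical in
      if 2 * x (regularGrid T n k) - a ≤ x T then
        ENNReal.ofReal (Real.exp (2 * c * (x T - x (regularGrid T n k)))) else 0 := by
  rw [reflectedWeight, Finset.sum_eq_single k]
  · simp [h]
  · exact fun l _ hl => if_neg fun h' => hl (h'.1.unique h)
  · exact fun h' => absurd (Finset.mem_range.2 (by omega)) h'

/-- A bound free of n, for dominated convergence. When the weight is nonzero, a < x(t_k) ≤ x T at
the exceedance index k, so 0 ≤ x T - x(t_k) ≤ x T - a. -/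
lemma reflectedWeight_le (c a : ℝ) (T : ℝ≥0) (n : ℕ) (x : ℝ≥0 → ℝ) :
    reflectedWeight c a T n x ≤ ENNReal.ofReal (Real.exp (2 * |c| * (x T - a))) := by
  rcases le_or_gt (x T) a with h | h
  · rw [reflectedWeight_of_le n h]
    exact zero_le
  obtain ⟨k, hk, hf⟩ := exists_isFirstExceed (x := fun j => x (regularGrid T n j)) (m := n + 1)
    (a := a) (by simpa using h)
  rw [reflectedWeight_of_isFirstExceed hk hf]
  split_ifs with hle
  · refine ENNReal.ofReal_le_ofReal (Real.exp_le_exp.2 ?_)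
    have h1 := hf.1
    simp only at h1
    have h2 : c * (x T - x (regularGrid T n k)) ≤ |c| * (x T - a) :=
      mul_le_mul (le_abs_self c) (by linarith) (by linarith) (abs_nonneg c)
    linarith
  · exact zero_le

lemma tendsto_reflectedWeight {x : ℝ≥0 → ℝ} (hx : Continuous x) {a : ℝ} (h0 : x 0 ≤ a) (c : ℝ)
    {T : ℝ≥0} (hT : x T ≠ a) :
    Tendsto (fun n => reflectedWeight c a T n x) atTop
      (𝓝 (if a < x T then ENNReal.ofReal (Real.exp (2 * c * (x T - a))) else 0)) := by
  rcases lt_or_gt_of_ne hT with h | h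
  · simp only [reflectedWeight_of_le _ h.le, if_neg h.not_gt]
    exact tendsto_const_nhds
  rw [if_pos h]
  have hex (n : ℕ) := exists_isFirstExceed (x := fun j => x (regularGrid T n j)) (m := n + 1)
    (a := a) (by simpa using h)
  choose k hk hf using hex
  have hlim : Tendsto (fun n => x (regularGrid T n (k n))) atTop (𝓝 a) := by
    refine tendsto_order.2 ⟨fun b hb => .of_forall fun n => hb.trans (hf n).1, fun b hb => ?_⟩
    filter_upwards [eventually_isFirstExceed_lt hx h0 (sub_pos.2 hb) T] with n hn
    simpa using hn (k n) (hk n) (hf n)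
  have hlim' : Tendsto (fun n => ENNReal.ofReal
      (Real.exp (2 * c * (x T - x (regularGrid T n (k n)))))) atTop
      (𝓝 (ENNReal.ofReal (Real.exp (2 * c * (x T - a))))) :=
    (ENNReal.continuous_ofReal.tendsto _).comp
      ((Real.continuous_exp.tendsto _).comp ((tendsto_const_nhds.sub hlim).const_mul _))
  refine hlim'.congr' ?_
  -- The condition 2 x(t_k) - a ≤ x T says that x(t_k) is at most this midpoint.
  have hm : (x T + a) / 2 > a := by linarith
  filter_upwards [hlim.eventually_lt_const hm] with n hn
  rw [reflectedWeight_of_isFirstExceed (hk n) (hf n), if_pos (by linarith)]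

/-! ### Measurability and the exact reflection formula on a grid -/

namespace ProbabilityTheory.IsPreBrownianReal

variable {Ω : Type*} [MeasurableSpace Ω] {P : Measure Ω} {B : ℝ≥0 → Ω → ℝ}

lemma nullMeasurableSet_isFirstExceed (hB : IsPreBrownianReal B P) (c a : ℝ) (t : ℕ → ℝ≥0)
    (k : ℕ) : NullMeasurableSet {ω | IsFirstExceed (fun j => B (t j) ω - c * t j) a k} P := by
  have hmeas (s : ℝ≥0) : AEMeasurable (fun ω => B s ω - c * s) P :=
    (hB.aemeasurable s).sub_const _
  have : {ω | IsFirstExceed (fun j => B (t j) ω - c * t j) a k} =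
      {ω | a < B (t k) ω - c * t k} ∩ ⋂ j, ⋂ (_ : j < k), {ω | B (t j) ω - c * t j ≤ a} := by
    ext ω
    simp [IsFirstExceed]
  rw [this]
  exact (nullMeasurableSet_lt aemeasurable_const (hmeas _)).inter
    (.iInter fun j => .iInter fun _ => nullMeasurableSet_le (hmeas _) aemeasurable_const)

open scoped Classical in
lemma aemeasurable_reflectedWeight_term (hB : IsPreBrownianReal B P) (c a : ℝ) (T : ℝ≥0)
    (n k : ℕ) :
    AEMeasurable (fun ω =>
      if IsFirstExceed (fun j => B (regularGrid T n j) ω - c * regularGrid T n j) a k ∧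
        2 * (B (regularGrid T n k) ω - c * regularGrid T n k) - a ≤ B T ω - c * T then
        ENNReal.ofReal (Real.exp (2 * c * ((B T ω - c * T) -
          (B (regularGrid T n k) ω - c * regularGrid T n k)))) else 0) P := by
  have hmeas (s : ℝ≥0) : AEMeasurable (fun ω => B s ω - c * s) P :=
    (hB.aemeasurable s).sub_const _
  have hexp : AEMeasurable (fun ω => ENNReal.ofReal (Real.exp (2 * c * ((B T ω - c * T) -
      (B (regularGrid T n k) ω - c * regularGrid T n k))))) P :=
    ENNReal.measurable_ofReal.comp_aemeasurable
      (Real.measurable_exp.comp_aemeasurable (((hmeas T).sub (hmeas _)).const_mul _))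
  have hset := (hB.nullMeasurableSet_isFirstExceed c a (regularGrid T n) k).inter
    (nullMeasurableSet_le (((hmeas (regularGrid T n k)).const_mul 2).sub_const a) (hmeas T))
  refine (hexp.indicator₀ hset).congr (.of_forall fun ω => ?_)
  rw [Set.indicator_apply]
  congr

lemma aemeasurable_reflectedWeight (hB : IsPreBrownianReal B P) (c a : ℝ) (T : ℝ≥0) (n : ℕ) :
    AEMeasurable (fun ω => reflectedWeight c a T n fun t => B t ω - c * t) P :=
  Finset.aemeasurable_fun_sum _ fun k _ => hB.aemeasurable_reflectedWeight_term c a T n k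

lemma measure_exceed_grid_and_le (hB : IsPreBrownianReal B P) (c a : ℝ) (T : ℝ≥0) (n : ℕ) :
    P {ω | (∃ k ≤ n + 1, a < B (regularGrid T n k) ω - c * regularGrid T n k) ∧
        B T ω - c * T ≤ a} =
      ∫⁻ ω, reflectedWeight c a T n (fun t => B t ω - c * t) ∂P := by
  classical
  have hmeas (s : ℝ≥0) : AEMeasurable (fun ω => B s ω - c * s) P :=
    (hB.aemeasurable s).sub_const _
  have hset : {ω | (∃ k ≤ n + 1, a < B (regularGrid T n k) ω - c * regularGrid T n k) ∧
        B T ω - c * T ≤ a} = ⋃ k ∈ Finset.range (n + 2),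
      {ω | IsFirstExceed (fun j => B (regularGrid T n j) ω - c * regularGrid T n j) a k ∧
        B T ω - c * T ≤ a} := by
    ext ω
    simp only [Set.mem_ofPred_eq, Set.mem_iUnion, Finset.mem_range, exists_prop]
    constructor
    · rintro ⟨⟨m, hm, hlt⟩, hT⟩
      obtain ⟨k, hk, hf⟩ := exists_isFirstExceed
        (x := fun j => B (regularGrid T n j) ω - c * regularGrid T n j) hlt
      exact ⟨k, by omega, hf, hT⟩
    · rintro ⟨k, hk, hf, hT⟩
      exact ⟨⟨k, by omega, hf.1⟩, hT⟩
  rw [hset, measure_biUnion_finset₀]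
  · unfold reflectedWeight
    rw [lintegral_finsetSum']
    · refine Finset.sum_congr rfl fun k hk => ?_
      rw [hB.lintegral_first_exceed_reflect c a (regularGrid_mono T n)
        (regularGrid_le (Nat.lt_succ_iff.1 (Finset.mem_range.1 hk)))]
      refine lintegral_congr fun ω => ?_
      rw [Set.indicator_apply]
      congr
    · exact fun k _ => hB.aemeasurable_reflectedWeight_term c a T n k
  · intro k _ l _ hkl
    refine (Set.disjoint_left.2 fun ω hk hl => hkl (hk.1.unique hl.1)).aedisjoint
  · exact fun k _ => (hB.nullMeasurableSet_isFirstExceed c a _ k).inter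
      (nullMeasurableSet_le (hmeas T) aemeasurable_const)

end ProbabilityTheory.IsPreBrownianReal

/-! ### From grids to continuous time -/

lemma lt_driftedSup_iff {Ω : Type*} {B : ℝ≥0 → Ω → ℝ} {ω : Ω} (hω : Continuous (B · ω))
    (c a : ℝ) (T : ℝ≥0) :
    a < driftedSup B c T ω ↔ ∃ t ≤ T, a < B t ω - c * t := by
  have : Nonempty (Set.Icc (0 : ℝ≥0) T) := ⟨0, by simp⟩
  have hbdd : BddAbove (Set.range fun t : Set.Icc (0 : ℝ≥0) T => B t ω - c * ((t : ℝ≥0) : ℝ)) := by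
    rw [← Set.image_eq_range (fun t : ℝ≥0 => B t ω - c * t)]
    exact (isCompact_Icc.image (by fun_prop)).bddAbove
  rw [driftedSup, lt_ciSup_iff hbdd]
  simp

/-- Convergence of measures of a.e. convergent null-measurable events. -/
lemma tendsto_measure_of_ae_eventually_mem_iff {α : Type*} [MeasurableSpace α] {μ : Measure α}
    [IsFiniteMeasure μ] {A : Set α} {As : ℕ → Set α} (hAs : ∀ n, NullMeasurableSet (As n) μ)
    (h : ∀ᵐ x ∂μ, ∀ᶠ n in atTop, x ∈ As n ↔ x ∈ A) :
    Tendsto (fun n => μ (As n)) atTop (𝓝 (μ A)) := by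
  -- Measurable versions of the events make their liminf measurable.
  choose A' hA' hAe using fun n => (hAs n).exists_measurable_superset_ae_eq
  have hmem : ∀ᵐ x ∂μ, ∀ n, x ∈ A' n ↔ x ∈ As n :=
    ae_all_iff.2 fun n => (hAe n).2.mem_iff
  have hlim : ∀ᵐ x ∂μ, x ∈ liminf A' atTop ↔ x ∈ A := by
    filter_upwards [h, hmem] with x hx hx'
    rw [Filter.mem_liminf_iff_eventually_mem]
    simp only [hx']
    refine ⟨fun h1 => ?_, fun h1 => hx.mono fun n hn => hn.2 h1⟩
    obtain ⟨n, hn1, hn2⟩ := (h1.and hx).exists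
    exact hn2.1 hn1
  rw [← measure_congr (Filter.eventuallyEq_set.2 hlim)]
  have hl := tendsto_measure_of_ae_tendsto_indicator_of_isFiniteMeasure atTop (μ := μ)
    (A := liminf A' atTop) (As := A') (.measurableSet_liminf fun n => (hAe n).1) (fun n => (hAe n).1) (by
      filter_upwards [h, hmem, hlim] with x hx hx' hl
      filter_upwards [hx] with n hn
      rw [hx', hn, hl])
  exact hl.congr fun n => measure_congr (hAe n).2

namespace ProbabilityTheory

variable {Ω : Type*} [MeasurableSpace Ω] {P : Measure Ω} {B : ℝ≥0 → Ω → ℝ}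

lemma IsBrownianReal.tendsto_measure_exceed_grid (hB : IsBrownianReal B P) (c a : ℝ) {T : ℝ≥0}
    (hT : 0 < T) :
    Tendsto (fun n => P {ω | ∃ k ≤ n + 1, a < B (regularGrid T n k) ω - c * regularGrid T n k})
      atTop (𝓝 (P {ω | a < driftedSup B c T ω})) := by
  have := hB.isGaussianProcess.isProbabilityMeasure
  refine tendsto_measure_of_ae_eventually_mem_iff (fun n => ?_) ?_
  · have hset : {ω | ∃ k ≤ n + 1, a < B (regularGrid T n k) ω - c * regularGrid T n k} =
        ⋃ k, ⋃ (_ : k ≤ n + 1), {ω | a < B (regularGrid T n k) ω - c * regularGrid T n k} := by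
      ext ω
      simp
    rw [hset]
    exact .iUnion fun k => .iUnion fun _ =>
      nullMeasurableSet_lt aemeasurable_const ((hB.aemeasurable _).sub_const _)
  · filter_upwards [hB.cont] with ω hω
    simp only [lt_driftedSup_iff hω]
    by_cases h : ∃ t ≤ T, a < B t ω - c * t
    · obtain ⟨t, ht, hlt⟩ := h
      obtain ⟨k, hk, hlim⟩ := exists_tendsto_regularGrid hT ht
      have hx : Continuous fun t : ℝ≥0 => B t ω - c * t := by fun_prop
      filter_upwards [((hx.tendsto t).comp hlim).eventually_const_lt hlt] with n hn
      exact ⟨fun _ => ⟨t, ht, hlt⟩, fun _ => ⟨k n, hk n, hn⟩⟩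
    · exact .of_forall fun n => ⟨fun ⟨k, hk, hlt⟩ => ⟨_, regularGrid_le hk, hlt⟩,
        fun h' => absurd h' h⟩

lemma IsPreBrownianReal.lintegral_exp_drift_lt_top (hB : IsPreBrownianReal B P) (b c a : ℝ)
    (T : ℝ≥0) :
    ∫⁻ ω, ENNReal.ofReal (Real.exp (b * ((B T ω - c * T) - a))) ∂P ≠ ⊤ := by
  have h := ((integrable_exp_mul_gaussianReal (μ := -(c * T)) (v := T) b).mul_const
    (Real.exp (-(b * a)))).lintegral_lt_top
  rw [← (hB.hasLaw_drift c T).lintegral_comp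
    (f := fun z => ENNReal.ofReal (Real.exp (b * z) * Real.exp (-(b * a)))) (by fun_prop)] at h
  refine ne_of_lt (lt_of_eq_of_lt (lintegral_congr fun ω => ?_) h)
  rw [← Real.exp_add]
  congr 2
  ring

lemma IsPreBrownianReal.measure_drift_gt (hB : IsPreBrownianReal B P) (c a : ℝ) {T : ℝ≥0}
    (hT : 0 < T) :
    P {ω | a < B T ω - c * T} = gaussianReal 0 1 (Set.Ioi ((a + c * T) / √(T : ℝ))) := by
  have hL := hB.hasLaw_drift c T
  have h : P {ω | a < B T ω - c * T} = gaussianReal (-(c * T)) T (Set.Ioi a) := by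
    rw [← hL.map_eq, Measure.map_apply_of_aemeasurable hL.aemeasurable measurableSet_Ioi]
    rfl
  rw [h, gaussianReal_Ioi_eq_standard _ hT.ne', sub_neg_eq_add]

/-- Gaussian reflection read backwards: the tilt exp(2cz) turns N(-cT, T) into N(cT, T), and
exp(-2ac) factors out. -/
lemma IsPreBrownianReal.lintegral_tilt_drift_gt (hB : IsPreBrownianReal B P) (c a : ℝ) {T : ℝ≥0}
    (hT : 0 < T) :
    ∫⁻ ω, (if a < B T ω - c * T then
        ENNReal.ofReal (Real.exp (2 * c * ((B T ω - c * T) - a))) else 0) ∂P =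
      ENNReal.ofReal (Real.exp (-2 * a * c)) *
        gaussianReal 0 1 (Set.Ioi ((a - c * T) / √(T : ℝ))) := by
  have hI : Measurable ((Set.Ioi a).indicator (1 : ℝ → ENNReal)) :=
    measurable_one.indicator measurableSet_Ioi
  have hL := hB.hasLaw_drift c T
  calc _ = ∫⁻ ω, ENNReal.ofReal (Real.exp (-2 * a * c)) *
          (ENNReal.ofReal (Real.exp (2 * c * (B T ω - c * T))) *
            (Set.Ioi a).indicator 1 (B T ω - c * T)) ∂P := by
        refine lintegral_congr fun ω => ?_
        simp only [Set.indicator_apply, Set.mem_Ioi, Pi.one_apply]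
        split_ifs
        · rw [mul_one, ← ENNReal.ofReal_mul (Real.exp_pos _).le, ← Real.exp_add]
          congr 2
          ring
        · simp
    _ = ENNReal.ofReal (Real.exp (-2 * a * c)) *
          ∫⁻ z, (Set.Ioi a).indicator 1 (-z) ∂gaussianReal (-(c * T)) T := by
        rw [lintegral_gaussianReal_comp_neg c T hI, ← lintegral_const_mul _ (by fun_prop)]
        exact hL.lintegral_comp (f := fun z => ENNReal.ofReal (Real.exp (-2 * a * c)) *
          (ENNReal.ofReal (Real.exp (2 * c * z)) * (Set.Ioi a).indicator 1 z)) (by fun_prop)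
    _ = ENNReal.ofReal (Real.exp (-2 * a * c)) * gaussianReal (c * T) T (Set.Ioi a) := by
        have hneg : (gaussianReal (-(c * T)) T).map (fun z => -z) = gaussianReal (c * T) T := by
          rw [gaussianReal_map_neg, neg_neg]
        rw [← lintegral_map (f := (Set.Ioi a).indicator 1) (g := fun z : ℝ => -z) hI
          measurable_neg, hneg, lintegral_indicator_one measurableSet_Ioi]
    _ = _ := by rw [gaussianReal_Ioi_eq_standard _ hT.ne']

/-- The law of the supremum of Brownian motion with drift over a finite horizon. -/
theorem IsBrownianReal.measure_lt_driftedSup (hB : IsBrownianReal B P) (c : ℝ) {a : ℝ}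
    {T : ℝ≥0} (ha : 0 ≤ a) (hT : 0 < T) :
    P {ω | a < driftedSup B c T ω} =
      gaussianReal 0 1 (Set.Ioi ((a + c * T) / √(T : ℝ))) +
        ENNReal.ofReal (Real.exp (-2 * a * c)) *
          gaussianReal 0 1 (Set.Ioi ((a - c * T) / √(T : ℝ))) := by
  have hBp := hB.toIsPreBrownianReal
  have hne : ∀ᵐ ω ∂P, B T ω - c * T ≠ a := by
    have hL := hBp.hasLaw_drift c T
    have := nullSingletonClass_gaussianReal (μ := -(c * T)) hT.ne'
    have h : ∀ᵐ z ∂P.map (fun ω => B T ω - c * T), z ≠ a := by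
      rw [hL.map_eq]
      exact Measure.ae_ne _ a
    exact ae_of_ae_map hL.aemeasurable h
  have hlim : Tendsto (fun n => ∫⁻ ω, reflectedWeight c a T n (fun t => B t ω - c * t) ∂P) atTop
      (𝓝 (∫⁻ ω, (if a < B T ω - c * T then
        ENNReal.ofReal (Real.exp (2 * c * ((B T ω - c * T) - a))) else 0) ∂P)) := by
    refine tendsto_lintegral_of_dominated_convergence'
      (fun ω => ENNReal.ofReal (Real.exp (2 * |c| * ((B T ω - c * T) - a))))
      (fun n => hBp.aemeasurable_reflectedWeight c a T n)
      (fun n => .of_forall fun ω => reflectedWeight_le c a T n fun t => B t ω - c * t)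
      (hBp.lintegral_exp_drift_lt_top _ c a T) ?_
    filter_upwards [hB.cont, hBp.eval_zero_ae_eq_zero, hne] with ω hω h0 hTa
    exact tendsto_reflectedWeight (x := fun t => B t ω - c * t) (by fun_prop)
      (by simpa [h0] using ha) c hTa
  have hsplit (n : ℕ) :
      P {ω | ∃ k ≤ n + 1, a < B (regularGrid T n k) ω - c * regularGrid T n k} =
        P {ω | a < B T ω - c * T} +
          ∫⁻ ω, reflectedWeight c a T n (fun t => B t ω - c * t) ∂P := by
    -- Split on whether X_T > a; since T is the last grid point, X_T > a already forces a grid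
    -- exceedance.
    rw [← hBp.measure_exceed_grid_and_le,
      ← measure_inter_add_sdiff₀ _ (nullMeasurableSet_lt aemeasurable_const
        (hBp.hasLaw_drift c T).aemeasurable : NullMeasurableSet {ω | a < B T ω - c * T} P)]
    congr 2
    · ext ω
      refine ⟨fun h => h.2, fun h => ⟨⟨n + 1, le_rfl, ?_⟩, h⟩⟩
      simpa using h
    · ext ω
      simp
  rw [← hBp.measure_drift_gt c a hT, ← hBp.lintegral_tilt_drift_gt c a hT]
  refine tendsto_nhds_unique (hB.tendsto_measure_exceed_grid c a hT) ?_
  simp only [hsplit]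
  exact hlim.const_add _

end ProbabilityTheory

/-! ### Real-valued formula and comparison of the two barriers -/

theorem marginalSurvival_eq {Ω : Type*} [MeasurableSpace Ω] {P : Measure Ω} {B : ℝ≥0 → Ω → ℝ}
    (hB : IsBrownianReal B P) (c : ℝ) {a : ℝ} {T : ℝ≥0} (ha : 0 ≤ a) (hT : 0 < T) :
    marginalSurvival P B c T a =
      gaussianTail ((a + c * T) / √(T : ℝ))
        + Real.exp (-2 * a * c) * gaussianTail ((a - c * T) / √(T : ℝ)) := by
  have h := hB.measure_lt_driftedSup c ha hT
  simp only [marginalSurvival, gaussianTail, Measure.real, gt_iff_lt, h]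
  rw [ENNReal.toReal_add (measure_ne_top _ _) (ENNReal.mul_ne_top ENNReal.ofReal_ne_top
    (measure_ne_top _ _)), ENNReal.toReal_mul, ENNReal.toReal_ofReal (Real.exp_pos _).le]

/-- Up to the crossing time of the two barriers, exceeding the upper barrier forces exceeding the
lower one. -/
lemma jointSurvival_eq_marginalSurvival {Ω : Type*} [MeasurableSpace Ω] {P : Measure Ω}
    {B : ℝ≥0 → Ω → ℝ} (hcont : ∀ᵐ ω ∂P, Continuous (B · ω)) {a₁ a₂ c₁ c₂ : ℝ} {T : ℝ≥0}
    (hc : c₂ < c₁) (hcross : (T : ℝ) ≤ crossingTime a₁ a₂ c₁ c₂) :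
    jointSurvival P B c₁ c₂ T a₁ a₂ = marginalSurvival P B c₂ T a₂ := by
  refine measureReal_congr ?_
  refine Filter.eventuallyEq_set.2 ?_
  filter_upwards [hcont] with ω hω
  simp only [gt_iff_lt, lt_driftedSup_iff hω, and_iff_right_iff_imp]
  rintro ⟨t, ht, hlt⟩
  refine ⟨t, ht, ?_⟩
  -- For t ≤ T this gives t(c₁ - c₂) ≤ a₂ - a₁, that is, a₁ + c₁t ≤ a₂ + c₂t.
  rw [crossingTime, le_div_iff₀ (sub_pos.2 hc)] at hcross
  have : (t : ℝ) * (c₁ - c₂) ≤ T * (c₁ - c₂) :=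
    mul_le_mul_of_nonneg_right (NNReal.coe_le_coe.2 ht) (sub_pos.2 hc).le
  linarith

theorem theorem2p1 {Ω : Type*} [MeasurableSpace Ω] (P : Measure Ω) (B : ℝ≥0 → Ω → ℝ)
    (hB : IsBrownianReal B P)
    (a₁ a₂ c₁ c₂ : ℝ) (T : ℝ≥0)
    (ha₁ : 0 < a₁) (ha : a₁ < a₂) (hc : c₂ < c₁) (hT : 0 < T)
    (hcross : (T : ℝ) ≤ crossingTime a₁ a₂ c₁ c₂) :
    jointSurvival P B c₁ c₂ T a₁ a₂ =
        gaussianTail ((a₂ + c₂ * T) / √(T : ℝ))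
          + Real.exp (-2 * a₂ * c₂) * gaussianTail ((a₂ - c₂ * T) / √(T : ℝ)) ∧
      jointSurvival P B c₁ c₂ T a₁ a₂ = marginalSurvival P B c₂ T a₂ := by
  have h := jointSurvival_eq_marginalSurvival (a₁ := a₁) (a₂ := a₂) hB.cont hc hcross
  exact ⟨h.trans (marginalSurvival_eq hB c₂ (ha₁.trans ha).le hT), h⟩
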